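/- Let $a,b\in\mathbb{Z}$ and let $K=\mathbb{Q}(\theta)$ be a cubic field, where the minimal polynomial of $\theta$ over $\mathbb{Q}$ is $X^3-aX+b$. Let $\mathcal{O}_K$ be the ring of integers of $K$ and put $\Delta=4a^3-27b^2$. For a prime number $p$ let $v_p$ denote the $p$-adic valuation on $\mathbb{Z}$, and consider the conditions (i) $p\mid a$, $p\mid b$ and $1=v_p(a)<v_p(b)$; (ii) $p\nmid ab$ and $v_p(\Delta)$ is odd. For an ideal $I\neq(0),(1)$ of $\mathcal{O}_K$ with factorization $I=P_1^{e_1}\cdots P_g^{e_g}$ into powers of distinct prime ideals, with $e_i\ge 1$ and $e_1\le\dots\le e_g$, let $\Omega(I)=e_1+\dots+e_g$ and let $$H(I)=-\sum_{i=1}^g\frac{e_i}{\Omega(I)}\log\frac{e_i}{\Omega(I)}$$ be its entropy. If $J=Q_1^{f_1}\cdots Q_g^{f_g}\neq(0),(1)$ is another ideal with the same number $g$ of distinct prime divisors and with $f_1\le\dots\le f_g$, the divergence of $I$ and $J$ is $$D(I\,\|\,J)=\log\frac{\Omega(J)}{\Omega(I)}-\frac{1}{\Omega(I)}\sum_{i=1}^g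 e_i\log\frac{f_i}{e_i}.$$ Let $p,q\ge 5$ be distinct primes, each of which satisfies (i) or (ii) (in particular, $p$ and $q$ may both satisfy (i), or both satisfy (ii)). Then each of $p\mathcal{O}_K$ and $q\mathcal{O}_K$ is of the form $P_1P_2^2$ with distinct nonzero prime ideals $P_1,P_2$ of $\mathcal{O}_K$, and $$H(p\mathcal{O}_K)=H(q\mathcal{O}_K),\qquad D(p\mathcal{O}_K\,\|\,q\mathcal{O}_K)=0.$$ -/

import Mathlib

open UniqueFactorizationMonoid

namespace IdealEntropy

open Classical in
/-- The set of distinct prime ideal divisors `P₁, …, P_g` of a nonzero ideal `I` of a Dedekind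
domain (such as the ring of integers of a number field). -/
noncomputable def primeDivisors {R : Type*} [CommRing R] [IsDedekindDomain R] (I : Ideal R) :
    Finset (Ideal R) :=
  (normalizedFactors I).toFinset

open Classical in
/-- The exponent `e` of `P` in the factorization of `I` into prime ideals. -/
noncomputable def exponent {R : Type*} [CommRing R] [IsDedekindDomain R] (I P : Ideal R) : ℕ :=
  (normalizedFactors I).count P

/-- `Ω(I) = e₁ + ⋯ + e_g`. -/
noncomputable def bigOmega {R : Type*} [CommRing R] [IsDedekindDomain R] (I : Ideal R) : ℕ :=
  ∑ P ∈ primeDivisors I, exponent I P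

/-- The entropy `H(I) = - ∑ᵢ (eᵢ / Ω(I)) log (eᵢ / Ω(I))` of an ideal `I ≠ (0), (1)`. -/
noncomputable def entropy {R : Type*} [CommRing R] [IsDedekindDomain R] (I : Ideal R) : ℝ :=
  -∑ P ∈ primeDivisors I,
    ((exponent I P : ℝ) / (bigOmega I : ℝ)) * Real.log ((exponent I P : ℝ) / (bigOmega I : ℝ))

/-- The exponents `e₁ ≤ e₂ ≤ ⋯ ≤ e_g` of the prime factorization of `I`, one for each distinct
prime divisor, listed in ascending order. -/
noncomputable def sortedExponents {R : Type*} [CommRing R] [IsDedekindDomain R] (I : Ideal R) :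
    List ℕ :=
  ((primeDivisors I).val.map (exponent I)).sort (· ≤ ·)

/-- The divergence
`D(I‖J) = log (Ω(J) / Ω(I)) - (1 / Ω(I)) ∑ᵢ eᵢ log (fᵢ / eᵢ)`
of two ideals `I, J ≠ (0), (1)` with the same number `g` of distinct prime divisors, where
`e₁ ≤ ⋯ ≤ e_g` and `f₁ ≤ ⋯ ≤ f_g` are their exponents in ascending order.
(The value has no meaning when the numbers of distinct prime divisors differ.) -/
noncomputable def divergence {R : Type*} [CommRing R] [IsDedekindDomain R] (I J : Ideal R) : ℝ :=
  Real.log ((bigOmega J : ℝ) / (bigOmega I : ℝ)) -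
    (1 / (bigOmega I : ℝ)) *
      (List.zipWith (fun e f : ℕ => (e : ℝ) * Real.log ((f : ℝ) / (e : ℝ)))
        (sortedExponents I) (sortedExponents J)).sum

/-- First condition on a prime `p`, for the polynomial `X³ - aX + b`:
`p ∣ a`, `p ∣ b` and `1 = v_p(a) < v_p(b)`. -/
def ConditionOne (a b : ℤ) (p : ℕ) : Prop :=
  (p : ℤ) ∣ a ∧ (p : ℤ) ∣ b ∧ 1 = padicValInt p a ∧ padicValInt p a < padicValInt p b

/-- Second condition on a prime `p`, for the polynomial `X³ - aX + b` of discriminant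
`Δ = 4a³ - 27b²`: `p ∤ ab` and `v_p(Δ)` is odd. -/
def ConditionTwo (a b : ℤ) (p : ℕ) : Prop :=
  ¬ (p : ℤ) ∣ a * b ∧ Odd (padicValInt p (4 * a ^ 3 - 27 * b ^ 2))

/-- `I = P₁ · P₂²` for two distinct nonzero prime ideals `P₁`, `P₂`. -/
def IsPrimeMulPrimeSq {R : Type*} [CommRing R] (I : Ideal R) : Prop :=
  ∃ P₁ P₂ : Ideal R, P₁.IsPrime ∧ P₂.IsPrime ∧ P₁ ≠ ⊥ ∧ P₂ ≠ ⊥ ∧ P₁ ≠ P₂ ∧ I = P₁ * P₂ ^ 2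

end IdealEntropy

/-! Entropy and divergence depend only on the exponents, so everything reduces to the shape `P₁ * P₂
^ 2`. As `p` has norm `p ^ 3`, it suffices to find distinct primes `P₁`, `P₂` above `p` with `p ∈ P₂
^ 2` (`isPrimeMulPrimeSq_span_natCast`). Both conditions supply an integer `ρ` of the field with `p
∣ ρ² (ρ + c)` and `p ∤ c`. Traces show that `p` divides neither `ρ²` nor `ρ + c`, so
`exists_primes_of_dvd_sq_mul` gives the two primes, with `ρ ∈ P₂`. Ramification at `P₂` is a parity
argument: some equation forces the valuation of `p` at `P₂` to be even. -/

namespace IdealEntropy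

open NumberField

/-! ### Invariants of the shape `P₁ * P₂ ^ 2`, and parity criteria for ramification. -/

section Dedekind

variable {R : Type*} [CommRing R] [IsDedekindDomain R]

open Classical in
theorem normalizedFactors_prime_mul_sq {P₁ P₂ : Ideal R} (h₁ : P₁.IsPrime) (h₂ : P₂.IsPrime)
    (hb₁ : P₁ ≠ ⊥) (hb₂ : P₂ ≠ ⊥) :
    normalizedFactors (P₁ * P₂ ^ 2) = {P₁, P₂, P₂} := by
  have i₁ := (Ideal.prime_of_isPrime hb₁ h₁).irreducible
  have i₂ := (Ideal.prime_of_isPrime hb₂ h₂).irreducible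
  rw [normalizedFactors_mul hb₁ (pow_ne_zero _ hb₂), normalizedFactors_pow,
    normalizedFactors_irreducible i₁, normalizedFactors_irreducible i₂, two_nsmul]
  simp only [normalize_eq]
  rfl

/-- The factorization type of `P₁ * P₂ ^ 2` in terms of `primeDivisors` and `exponent`. -/
theorem IsPrimeMulPrimeSq.exists_primeDivisors_eq {I : Ideal R} (h : IsPrimeMulPrimeSq I) :
    ∃ P₁ P₂ : Ideal R, P₁ ≠ P₂ ∧ primeDivisors I = {P₁, P₂} ∧ exponent I P₁ = 1 ∧
      exponent I P₂ = 2 := by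
  classical
  obtain ⟨P₁, P₂, h₁, h₂, hb₁, hb₂, hne, rfl⟩ := h
  have key := normalizedFactors_prime_mul_sq h₁ h₂ hb₁ hb₂
  refine ⟨P₁, P₂, hne, ?_, ?_, ?_⟩
  · ext Q
    simp [primeDivisors, key]
  · simp only [exponent, key]
    simp [hne]
  · simp only [exponent, key]
    simp [hne.symm]

theorem IsPrimeMulPrimeSq.bigOmega_eq {I : Ideal R} (h : IsPrimeMulPrimeSq I) :
    bigOmega I = 3 := by
  obtain ⟨P₁, P₂, hne, hI, e₁, e₂⟩ := h.exists_primeDivisors_eq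
  rw [bigOmega, hI, Finset.sum_pair hne, e₁, e₂]

theorem IsPrimeMulPrimeSq.entropy_eq {I : Ideal R} (h : IsPrimeMulPrimeSq I) :
    entropy I = -(1 / 3 * Real.log (1 / 3) + 2 / 3 * Real.log (2 / 3)) := by
  have hO := h.bigOmega_eq
  obtain ⟨P₁, P₂, hne, hI, e₁, e₂⟩ := h.exists_primeDivisors_eq
  rw [entropy, hI, Finset.sum_pair hne, e₁, e₂, hO]
  norm_num

theorem IsPrimeMulPrimeSq.sortedExponents_eq {I : Ideal R} (h : IsPrimeMulPrimeSq I) :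
    sortedExponents I = [1, 2] := by
  classical
  obtain ⟨P₁, P₂, hne, hI, e₁, e₂⟩ := h.exists_primeDivisors_eq
  have : (primeDivisors I).val.map (exponent I) = {1, 2} := by
    rw [hI, Finset.insert_val_of_notMem (by simpa using hne)]
    simp [e₁, e₂]
  rw [sortedExponents, this]
  exact List.Perm.eq_of_pairwise' (r := (· ≤ ·)) (Multiset.pairwise_sort _ _) (by decide)
    (Multiset.coe_eq_coe.1 (Multiset.sort_eq _ _))

theorem IsPrimeMulPrimeSq.divergence_eq_zero {I J : Ideal R} (hI : IsPrimeMulPrimeSq I)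
    (hJ : IsPrimeMulPrimeSq J) : divergence I J = 0 := by
  rw [divergence, hI.bigOmega_eq, hJ.bigOmega_eq, hI.sortedExponents_eq, hJ.sortedExponents_eq]
  simp

theorem mem_sq_of_sq_eq_mul {P : Ideal R} (hP : P.IsPrime) {π x y : R} (hπ : π ∈ P)
    (hy : y ∉ P) (h : x ^ 2 = y * π) : π ∈ P ^ 2 := by
  have hx : x ∈ P := hP.mem_of_pow_mem 2 (h ▸ P.mul_mem_left y hπ)
  exact (Ideal.IsPrime.mul_mem_pow P (h ▸ Ideal.pow_mem_pow hx 2)).resolve_left hy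

open Classical in
theorem count_normalizedFactors_span_mul (P : Ideal R) {x y : R} (hx : x ≠ 0) (hy : y ≠ 0) :
    (normalizedFactors (Ideal.span {x * y})).count P =
      (normalizedFactors (Ideal.span {x})).count P +
        (normalizedFactors (Ideal.span {y})).count P := by
  rw [← Ideal.span_singleton_mul_span_singleton, normalizedFactors_mul (by simpa using hx)
    (by simpa using hy), Multiset.count_add]

open Classical in
theorem count_normalizedFactors_span_pow (P : Ideal R) (x : R) (n : ℕ) :
    (normalizedFactors (Ideal.span {x ^ n})).count P =
      n * (normalizedFactors (Ideal.span {x})).count P := by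
  rw [← Ideal.span_singleton_pow, normalizedFactors_pow, Multiset.count_nsmul]

open Classical in
theorem count_normalizedFactors_span_of_notMem {P : Ideal R} {x : R}
    (hx : x ∉ P) : (normalizedFactors (Ideal.span {x})).count P = 0 := by
  rw [Multiset.count_eq_zero]
  intro h
  exact hx ((Ideal.span_singleton_le_iff_mem _).1 (Ideal.le_of_dvd (dvd_of_mem_normalizedFactors h)))

/-- Comparing valuations at `P` gives `n * v(π) = 2 * v(x)`. If `π ∉ P ^ 2`, then `v(π) = 1` and `n`
would be even. -/
theorem mem_sq_of_odd_pow_mul_eq {P : Ideal R} (hP : P.IsPrime) {π x u w : R} (hπ : π ∈ P)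
    (hπ0 : π ≠ 0) (hu : u ∉ P) (hw : w ∉ P) {n : ℕ} (hn : Odd n)
    (h : π ^ n * u = x ^ 2 * w) : π ∈ P ^ 2 := by
  classical
  by_contra hcon
  have hu0 : u ≠ 0 := fun h0 ↦ hu (h0 ▸ P.zero_mem)
  have hw0 : w ≠ 0 := fun h0 ↦ hw (h0 ▸ P.zero_mem)
  have hx0 : x ^ 2 ≠ 0 := by
    intro h0
    rw [h0, zero_mul] at h
    exact mul_ne_zero (pow_ne_zero n hπ0) hu0 h
  have hc : (normalizedFactors (Ideal.span {π})).count P = 1 :=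
    Ideal.count_normalizedFactors_eq (by simpa using hπ) (by simpa using hcon)
  have := congrArg (fun z ↦ (normalizedFactors (Ideal.span {z})).count P) h
  simp only [count_normalizedFactors_span_mul P (pow_ne_zero n hπ0) hu0,
    count_normalizedFactors_span_mul P hx0 hw0, count_normalizedFactors_span_pow,
    count_normalizedFactors_span_of_notMem hu, count_normalizedFactors_span_of_notMem hw,
    hc] at this
  obtain ⟨k, hk⟩ := hn
  omega

end Dedekind

/-! ### Norms of primes above `p`, and how such primes are produced. -/

section Order

variable {R : Type*} [CommRing R] [IsDedekindDomain R] [Module.Free ℤ R] [Module.Finite ℤ R]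

theorem dvd_absNorm_of_natCast_mem {p : ℕ} (hp : p.Prime) {P : Ideal R}
    (hP : P.IsPrime) (h : (p : R) ∈ P) : p ∣ Ideal.absNorm P := by
  have h1 : Ideal.absNorm P ∣ p ^ Module.finrank ℤ R := by
    rw [← Ideal.absNorm_span_natCast (S := R)]
    exact Ideal.absNorm_dvd_absNorm_of_le ((Ideal.span_singleton_le_iff_mem _).2 h)
  obtain ⟨k, -, hk⟩ := (Nat.dvd_prime_pow hp).1 h1
  rcases k with _ | k
  · exact absurd (Ideal.absNorm_eq_one_iff.1 (by simpa using hk)) hP.ne_top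
  · exact hk ▸ dvd_pow_self p k.succ_ne_zero

/-- In a cubic order, a prime number lying in `P₁` and in `P₂ ^ 2` factors as `P₁ * P₂ ^ 2`. -/
theorem isPrimeMulPrimeSq_span_natCast [CharZero R] (hrank : Module.finrank ℤ R = 3) {p : ℕ}
    (hp : p.Prime)
    {P₁ P₂ : Ideal R} (h₁ : P₁.IsPrime) (h₂ : P₂.IsPrime) (hne : P₁ ≠ P₂) (hm₁ : (p : R) ∈ P₁)
    (hm₂ : (p : R) ∈ P₂ ^ 2) : IsPrimeMulPrimeSq (Ideal.span {(p : R)}) := by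
  have hp0 : (p : R) ≠ 0 := Nat.cast_ne_zero.2 hp.ne_zero
  have hm₂' : (p : R) ∈ P₂ := Ideal.pow_le_self two_ne_zero hm₂
  have hb₁ : P₁ ≠ ⊥ := by rintro rfl; exact hp0 (by simpa using hm₁)
  have hb₂ : P₂ ≠ ⊥ := by rintro rfl; exact hp0 (by simpa using hm₂')
  have := h₁.isMaximal hb₁
  have := h₂.isMaximal hb₂
  have hcop : IsCoprime P₁ (P₂ ^ 2) := (Ideal.isCoprime_of_isMaximal hne).pow_right
  obtain ⟨J, hJ⟩ : P₁ * P₂ ^ 2 ∣ Ideal.span {(p : R)} :=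
    hcop.mul_dvd (Ideal.dvd_iff_le.2 ((Ideal.span_singleton_le_iff_mem _).2 hm₁))
      (Ideal.dvd_iff_le.2 ((Ideal.span_singleton_le_iff_mem _).2 hm₂))
  refine ⟨P₁, P₂, h₁, h₂, hb₁, hb₂, hne, ?_⟩
  have hnorm := congrArg Ideal.absNorm hJ
  rw [Ideal.absNorm_span_natCast, hrank, map_mul, map_mul, map_pow] at hnorm
  obtain ⟨m, hm⟩ := dvd_absNorm_of_natCast_mem hp h₁ hm₁
  obtain ⟨n, hn⟩ := dvd_absNorm_of_natCast_mem hp h₂ hm₂'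
  rw [hm, hn] at hnorm
  have h1 : m * n ^ 2 * Ideal.absNorm J = 1 := by
    apply Nat.eq_of_mul_eq_mul_left (pow_pos hp.pos 3)
    linear_combination -hnorm
  rw [hJ, Ideal.absNorm_eq_one_iff.1 (Nat.eq_one_of_mul_eq_one_left h1), Ideal.mul_top]

end Order

/-- If `p` and `x` were comaximal, `p ∣ x * y` would force `p ∣ y`; so some maximal ideal contains
both. -/
theorem exists_prime_mem_of_not_dvd {R : Type*} [CommRing R] {p : ℕ} {x y : R} (hxy : (p : R) ∣ x * y)
    (hy : ¬ (p : R) ∣ y) : ∃ P : Ideal R, P.IsPrime ∧ (p : R) ∈ P ∧ x ∈ P := by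
  have hne : Ideal.span {(p : R), x} ≠ ⊤ := by
    intro h
    rw [Ideal.eq_top_iff_one, Ideal.mem_span_pair] at h
    replace h : IsCoprime (p : R) x := h
    exact hy (h.dvd_of_dvd_mul_left hxy)
  obtain ⟨P, hP, hle⟩ := Ideal.exists_le_maximal _ hne
  exact ⟨P, hP.isPrime, hle (Ideal.subset_span (by simp)), hle (Ideal.subset_span (by simp))⟩

theorem intCast_notMem {R : Type*} [CommRing R] {P : Ideal R} (hP : P.IsPrime) {p : ℕ}
    (hp : p.Prime) (hpP : (p : R) ∈ P) {m : ℤ} (hm : ¬ (p : ℤ) ∣ m) : (m : R) ∉ P := by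
  intro h
  obtain ⟨u, v, huv⟩ := (Int.prime_iff_natAbs_prime.2 (by simpa using hp)).coprime_iff_not_dvd.2 hm
  apply hP.ne_top
  rw [Ideal.eq_top_iff_one]
  have : (1 : R) = u * p + v * m := by exact_mod_cast (congrArg (Int.cast : ℤ → R) huv).symm
  rw [this]
  exact P.add_mem (P.mul_mem_left _ hpP) (P.mul_mem_left _ h)

/-- If `p` divides `ρ² (ρ + c)` but neither `ρ²` nor `ρ + c`, where `p ∤ c`, then there are two
distinct primes above `p`, the second of which contains `ρ`. -/
theorem exists_primes_of_dvd_sq_mul {R : Type*} [CommRing R] {p : ℕ} (hp : p.Prime) {ρ : R} {c : ℤ}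
    (hc : ¬ (p : ℤ) ∣ c) (h : (p : R) ∣ ρ ^ 2 * (ρ + c)) (h₁ : ¬ (p : R) ∣ ρ ^ 2)
    (h₂ : ¬ (p : R) ∣ ρ + c) :
    ∃ P₁ P₂ : Ideal R, P₁.IsPrime ∧ P₂.IsPrime ∧ P₁ ≠ P₂ ∧ (p : R) ∈ P₁ ∧
      (p : R) ∈ P₂ ∧ ρ ∈ P₂ := by
  obtain ⟨P₂, hP₂, hp₂, hρ⟩ := exists_prime_mem_of_not_dvd h h₂
  obtain ⟨P₁, hP₁, hp₁, hρ'⟩ := exists_prime_mem_of_not_dvd (mul_comm (ρ ^ 2) _ ▸ h) h₁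
  refine ⟨P₁, P₂, hP₁, hP₂, ?_, hp₁, hp₂, hP₂.mem_of_pow_mem 2 hρ⟩
  rintro rfl
  exact intCast_notMem hP₁ hp hp₁ hc
    ((P₁.add_mem_iff_right (hP₁.mem_of_pow_mem 2 hρ)).1 hρ')

/-! ### Traces in the cubic field, and the two conditions. -/

section Cubic

variable {K : Type*} [Field K] [NumberField K] {θ : K} {a b : ℤ}

theorem cubic_eq (hmin : minpoly ℚ θ =
      Polynomial.X ^ 3 - Polynomial.C (a : ℚ) * Polynomial.X + Polynomial.C (b : ℚ)) :
    θ ^ 3 = a * θ - b := by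
  have h := minpoly.aeval ℚ θ
  simp only [hmin, map_add, map_sub, map_mul, map_pow, Polynomial.aeval_X, map_intCast] at h
  linear_combination h

theorem finrank_eq_three (hmin : minpoly ℚ θ =
      Polynomial.X ^ 3 - Polynomial.C (a : ℚ) * Polynomial.X + Polynomial.C (b : ℚ))
    (hgen : IntermediateField.adjoin ℚ {θ} = ⊤) : Module.finrank ℚ K = 3 := by
  rw [← (Field.primitive_element_iff_minpoly_natDegree_eq ℚ θ).1 hgen, hmin]
  compute_degree!

/-- The trace of a quadratic polynomial in a generator of a cubic field. -/
theorem trace_quadratic (hmin : minpoly ℚ θ =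
      Polynomial.X ^ 3 - Polynomial.C (a : ℚ) * Polynomial.X + Polynomial.C (b : ℚ))
    (hgen : IntermediateField.adjoin ℚ {θ} = ⊤) (x y z : ℚ) :
    Algebra.trace ℚ K (algebraMap ℚ K x + y • θ + z • θ ^ 2) = 3 * x + 2 * a * z := by
  have hd := finrank_eq_three hmin hgen
  have hdeg : (minpoly ℚ θ).natDegree = 3 := by
    rw [(Field.primitive_element_iff_minpoly_natDegree_eq ℚ θ).1 hgen, hd]
  have hli : LinearIndependent ℚ fun i : Fin 3 ↦ θ ^ (i : ℕ) := by
    have := linearIndependent_pow (K := ℚ) θ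
    rwa [hdeg] at this
  let B := basisOfLinearIndependentOfCardEqFinrank hli (by simp [hd])
  have hB (i : Fin 3) : B i = θ ^ (i : ℕ) := by simp [B]
  have hθ := cubic_eq hmin
  have hdiag (c : Fin 3 → ℚ) (w : K) (i : Fin 3)
      (h : w = c 0 • B 0 + c 1 • B 1 + c 2 • B 2) : B.repr w i = c i := by
    have : w = ∑ j, c j • B j := by rw [h, Fin.sum_univ_three]
    rw [this, B.repr_sum_self]
  -- Each vector below holds the coordinates of a multiple of a basis element in `1, θ, θ²`, with
  -- `θ³` and `θ⁴` reduced by the cubic; only the diagonal coordinate counts.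
  have t1 : Algebra.trace ℚ K θ = 0 := by
    rw [Algebra.trace_eq_matrix_trace B, Matrix.trace, Fin.sum_univ_three]
    simp only [Matrix.diag_apply, Algebra.leftMulMatrix_eq_repr_mul]
    rw [hdiag ![0, 1, 0] _ 0 (by simp [hB]), hdiag ![0, 0, 1] _ 1 (by simp [hB]; ring),
      hdiag ![-b, a, 0] _ 2 (by simp [hB, Algebra.smul_def]; linear_combination hθ)]
    simp
  have t2 : Algebra.trace ℚ K (θ ^ 2) = 2 * a := by
    rw [Algebra.trace_eq_matrix_trace B, Matrix.trace, Fin.sum_univ_three]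
    simp only [Matrix.diag_apply, Algebra.leftMulMatrix_eq_repr_mul]
    rw [hdiag ![0, 0, 1] _ 0 (by simp [hB]),
      hdiag ![-b, a, 0] _ 1 (by simp [hB, Algebra.smul_def]; linear_combination hθ),
      hdiag ![0, -b, a] _ 2 (by simp [hB, Algebra.smul_def]; linear_combination θ * hθ)]
    simp
    ring
  rw [map_add, map_add, map_smul, map_smul, t1, t2, Algebra.trace_algebraMap, hd]
  simp
  ring

/-- The trace is `ℤ`-linear with integer values on `𝓞 K`. It serves to refute divisibility by `p`
without an integral basis. -/
theorem dvd_of_trace_eq {x : 𝓞 K} {m t : ℤ} (h : (m : 𝓞 K) ∣ x)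
    (ht : Algebra.trace ℚ K x = t) : m ∣ t := by
  obtain ⟨y, rfl⟩ := h
  refine ⟨Algebra.trace ℤ (𝓞 K) y, ?_⟩
  rw [← Algebra.coe_trace_int] at ht
  have : (m : 𝓞 K) * y = m • y := by simp
  rw [this, map_smul] at ht
  exact_mod_cast ht.symm

theorem isIntegral_of_minpoly_eq (hmin : minpoly ℚ θ =
      Polynomial.X ^ 3 - Polynomial.C (a : ℚ) * Polynomial.X + Polynomial.C (b : ℚ)) :
    IsIntegral ℤ θ := by
  refine ⟨Polynomial.X ^ 3 - Polynomial.C a * Polynomial.X + Polynomial.C b, by monicity!, ?_⟩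
  rw [← Polynomial.aeval_def]
  simp [cubic_eq hmin]

theorem not_intCast_dvd_of_prime {p : ℕ} (hp : p.Prime) (hp5 : 5 ≤ p) {m : ℤ} {i j : ℕ}
    (hm : ¬ (p : ℤ) ∣ m) : ¬ (p : ℤ) ∣ 2 ^ i * 3 ^ j * m := by
  have hpI : Prime (p : ℤ) := Nat.prime_iff_prime_int.1 hp
  intro h
  rcases hpI.dvd_or_dvd h with h | h
  · rcases hpI.dvd_or_dvd h with h | h
    · have := Int.le_of_dvd (by norm_num) (hpI.dvd_of_dvd_pow h)
      omega
    · have := Int.le_of_dvd (by norm_num) (hpI.dvd_of_dvd_pow h)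
      omega
  · exact hm h

theorem exists_primes_of_conditionOne (hmin : minpoly ℚ θ =
      Polynomial.X ^ 3 - Polynomial.C (a : ℚ) * Polynomial.X + Polynomial.C (b : ℚ))
    (hgen : IntermediateField.adjoin ℚ {θ} = ⊤) {p : ℕ} (hp : p.Prime) (hp5 : 5 ≤ p)
    (h : ConditionOne a b p) :
    ∃ P₁ P₂ : Ideal (𝓞 K), P₁.IsPrime ∧ P₂.IsPrime ∧ P₁ ≠ P₂ ∧ (p : 𝓞 K) ∈ P₁ ∧
      (p : 𝓞 K) ∈ P₂ ^ 2 := by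
  have : Fact p.Prime := ⟨hp⟩
  have hpI : Prime (p : ℤ) := Nat.prime_iff_prime_int.1 hp
  obtain ⟨-, -, hva, hvb⟩ := h
  have ha2 : ¬ (p : ℤ) ^ 2 ∣ a := by
    rw [padicValInt_dvd_iff]
    rintro (rfl | h)
    · simp at hva
    · omega
  -- From here `a` and `b` denote the original coefficients divided by `p` and `p ^ 2`.
  obtain ⟨a, rfl⟩ : (p : ℤ) ∣ a := by
    simpa using (padicValInt_dvd_iff 1 a).2 (.inr hva.le)
  obtain ⟨b, rfl⟩ : (p : ℤ) ^ 2 ∣ b := (padicValInt_dvd_iff 2 b).2 (.inr (by omega))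
  have ha : ¬ (p : ℤ) ∣ a := fun h ↦ ha2 (by rw [sq]; exact mul_dvd_mul_left _ h)
  have hθ := cubic_eq hmin
  push_cast at hθ
  have hpK : (p : K) ≠ 0 := Nat.cast_ne_zero.2 hp.ne_zero
  have hpQ : (p : ℚ) ≠ 0 := Nat.cast_ne_zero.2 hp.ne_zero
  -- `θ² / p` is integral, being a root of `X (X - a)² - p b²`. Modulo `p` this has the simple root
  -- `0` and the double root `a`, whence `ρ = γ - a`, `c = a`.
  obtain ⟨g, hgθ⟩ : ∃ g : K, θ ^ 2 = p * g := ⟨θ ^ 2 / p, by field_simp⟩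
  have hg2 : g ^ 2 = a * g - b * θ := by
    apply mul_left_cancel₀ (pow_ne_zero 2 hpK)
    linear_combination θ * hθ - (θ ^ 2 + p * g) * hgθ + p * a * hgθ
  have hgeq : g * (g - a) ^ 2 = p * b ^ 2 := by
    have : θ * (g - a) = - (p * b) := by
      apply mul_left_cancel₀ hpK
      linear_combination hθ - θ * hgθ
    apply mul_left_cancel₀ hpK
    linear_combination -(g - a) ^ 2 * hgθ + (θ * (g - a) - p * b) * this
  have hgint : IsIntegral ℤ g := by
    refine ⟨Polynomial.X * (Polynomial.X - Polynomial.C a) ^ 2 - Polynomial.C ((p : ℤ) * b ^ 2),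
      ?_, ?_⟩
    · monicity!
    · rw [← Polynomial.aeval_def]
      simp [hgeq]
  obtain ⟨γ, hγK⟩ := (IsIntegralClosure.isIntegral_iff (A := 𝓞 K)).1 hgint
  obtain ⟨Θ, hΘK⟩ := (IsIntegralClosure.isIntegral_iff (A := 𝓞 K)).1
    (isIntegral_of_minpoly_eq hmin)
  have hγΘ : Θ ^ 2 = γ * p := RingOfIntegers.ext (by simp [hγK, hΘK, hgθ, mul_comm])
  have hγ : γ * (γ - a) ^ 2 = p * b ^ 2 := RingOfIntegers.ext (by simp [hγK, hgeq])
  obtain ⟨P₁, P₂, h₁, h₂, hne, hp₁, hp₂, hρ⟩ :=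
    exists_primes_of_dvd_sq_mul hp (ρ := γ - a) ha
      ⟨b ^ 2, by linear_combination hγ⟩
      -- The trace of `(γ - a)²` is `a²`; that of `γ`, used next, is `2a`.
      (fun hd ↦ by
        refine ha (hpI.dvd_of_dvd_pow (n := 2) (dvd_of_trace_eq (K := K) (m := p)
          (by simpa using hd) ?_))
        convert trace_quadratic hmin hgen (a ^ 2) (-b) (-a / p) using 1
        · congr 1
          rw [hgθ]
          simp [Algebra.smul_def, hγK]
          field_simp
          linear_combination hg2
        · push_cast
          field_simp
          ring)
      (fun hd ↦ by
        refine not_intCast_dvd_of_prime hp hp5 (i := 1) (j := 0) ha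
          (dvd_of_trace_eq (K := K) (m := p) (by simpa using hd) ?_)
        convert trace_quadratic hmin hgen 0 0 (1 / p) using 1
        · congr 1
          simp [Algebra.smul_def, hγK, hgθ, hpK]
        · push_cast
          field_simp
          ring)
  -- `γ ≡ a` is a unit modulo `P₂`, so `Θ² = γ p` makes the valuation of `p` even.
  refine ⟨P₁, P₂, h₁, h₂, hne, hp₁, mem_sq_of_sq_eq_mul h₂ hp₂ (fun hγ' ↦ ?_) hγΘ⟩
  exact intCast_notMem h₂ hp hp₂ ha ((P₂.sub_mem_iff_right hγ').1 hρ)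

theorem exists_primes_of_conditionTwo (hmin : minpoly ℚ θ =
      Polynomial.X ^ 3 - Polynomial.C (a : ℚ) * Polynomial.X + Polynomial.C (b : ℚ))
    (hgen : IntermediateField.adjoin ℚ {θ} = ⊤) {p : ℕ} (hp : p.Prime) (hp5 : 5 ≤ p)
    (h : ConditionTwo a b p) :
    ∃ P₁ P₂ : Ideal (𝓞 K), P₁.IsPrime ∧ P₂.IsPrime ∧ P₁ ≠ P₂ ∧ (p : 𝓞 K) ∈ P₁ ∧
      (p : 𝓞 K) ∈ P₂ ^ 2 := by
  have : Fact p.Prime := ⟨hp⟩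
  have hpI : Prime (p : ℤ) := Nat.prime_iff_prime_int.1 hp
  obtain ⟨hab, hodd⟩ := h
  have hb : ¬ (p : ℤ) ∣ b := fun h ↦ hab (h.mul_left a)
  set Δ := 4 * a ^ 3 - 27 * b ^ 2 with hΔ
  set n := padicValInt p Δ with hn
  have hΔ0 : Δ ≠ 0 := fun h0 ↦ by simp [hn, h0] at hodd
  obtain ⟨m, hm⟩ : (p : ℤ) ^ n ∣ Δ := (padicValInt_dvd_iff n Δ).2 (.inr le_rfl)
  have hpm : ¬ (p : ℤ) ∣ m := by
    intro hd
    have : (p : ℤ) ^ (n + 1) ∣ Δ := by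
      rw [hm, pow_succ]
      exact mul_dvd_mul_left _ hd
    rcases (padicValInt_dvd_iff _ _).1 this with h | h
    · exact hΔ0 h
    · omega
  have hpΔ : (p : ℤ) ∣ Δ := hm ▸ (dvd_pow_self _ hodd.pos.ne').mul_right m
  have hθ := cubic_eq hmin
  obtain ⟨Θ, hΘK⟩ := (IsIntegralClosure.isIntegral_iff (A := 𝓞 K)).1
    (isIntegral_of_minpoly_eq hmin)
  have hΘ : Θ ^ 3 = a * Θ - b := RingOfIntegers.ext (by simp [hΘK, hθ])
  -- Modulo `p` the cubic has the double root `3b / 2a` and the simple root `-3b / a`; there `ρ`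
  -- takes the values `0` and `-9b`.
  set ρ : 𝓞 K := 2 * a * Θ - 3 * b with hρdef
  have hρeq : ρ ^ 2 * (ρ + (9 * b : ℤ)) = (Δ : 𝓞 K) * (ρ + b) := by
    rw [hρdef, hΔ]
    push_cast
    linear_combination 8 * a ^ 3 * hΘ
  have h9b : ¬ (p : ℤ) ∣ 9 * b := by
    simpa using not_intCast_dvd_of_prime hp hp5 (i := 0) (j := 2) hb
  obtain ⟨P₁, P₂, h₁, h₂, hne, hp₁, hp₂, hρ⟩ :=
    exists_primes_of_dvd_sq_mul hp (ρ := ρ) h9b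
      (hρeq ▸ Dvd.dvd.mul_right (by simpa using map_dvd (Int.castRingHom (𝓞 K)) hpΔ) _)
      (fun hd ↦ by
        have h2 : (p : ℤ) ∣ 2 * Δ + 81 * b ^ 2 := by
          refine dvd_of_trace_eq (K := K) (m := p) (by simpa using hd) ?_
          convert trace_quadratic hmin hgen (9 * b ^ 2) (-12 * a * b) (4 * a ^ 2) using 1
          · congr 1
            simp [Algebra.smul_def, hρdef, hΘK, map_ofNat]
            ring
          · push_cast [hΔ]
            ring
        have h3 : (p : ℤ) ∣ 2 ^ 0 * 3 ^ 4 * b ^ 2 := by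
          simpa using (Int.dvd_add_right (hpΔ.mul_left 2)).1 h2
        exact not_intCast_dvd_of_prime hp hp5 (fun h ↦ hb (hpI.dvd_of_dvd_pow h)) h3)
      (fun hd ↦ by
        refine not_intCast_dvd_of_prime hp hp5 (i := 1) (j := 2) hb
          (dvd_of_trace_eq (K := K) (m := p) (by simpa using hd) ?_)
        convert trace_quadratic hmin hgen (6 * b) (2 * a) 0 using 1
        · congr 1
          simp [Algebra.smul_def, hρdef, hΘK, map_ofNat]
          ring
        · push_cast
          ring)
  -- The cofactors of `p ^ n` and `ρ²` in `hρeq` avoid `P₂`, so the odd `n` forces ramification.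
  have hn₁ : (m : 𝓞 K) * (ρ + b) ∉ P₂ := by
    intro h
    rcases h₂.mem_or_mem h with h | h
    · exact intCast_notMem h₂ hp hp₂ hpm h
    · exact intCast_notMem h₂ hp hp₂ hb ((P₂.add_mem_iff_right hρ).1 h)
  have hn₂ : ρ + (9 * b : ℤ) ∉ P₂ := fun h ↦
    intCast_notMem h₂ hp hp₂ h9b ((P₂.add_mem_iff_right hρ).1 h)
  refine ⟨P₁, P₂, h₁, h₂, hne, hp₁, mem_sq_of_odd_pow_mul_eq h₂ hp₂
    (Nat.cast_ne_zero.2 hp.ne_zero) hn₁ hn₂ hodd (x := ρ) ?_⟩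
  rw [hρeq, hm]
  push_cast
  ring

theorem isPrimeMulPrimeSq_of_condition (hmin : minpoly ℚ θ =
      Polynomial.X ^ 3 - Polynomial.C (a : ℚ) * Polynomial.X + Polynomial.C (b : ℚ))
    (hgen : IntermediateField.adjoin ℚ {θ} = ⊤) {p : ℕ} (hp : p.Prime) (hp5 : 5 ≤ p)
    (h : ConditionOne a b p ∨ ConditionTwo a b p) :
    IsPrimeMulPrimeSq (Ideal.span {(p : 𝓞 K)}) := by
  obtain ⟨P₁, P₂, h₁, h₂, hne, hm₁, hm₂⟩ := h.elim
    (exists_primes_of_conditionOne hmin hgen hp hp5)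
    (exists_primes_of_conditionTwo hmin hgen hp hp5)
  exact isPrimeMulPrimeSq_span_natCast
    ((RingOfIntegers.rank K).trans (finrank_eq_three hmin hgen)) hp h₁ h₂ hne hm₁ hm₂

end Cubic

end IdealEntropy

theorem proposition3p9 {K : Type*} [Field K] [NumberField K] (θ : K) (a b : ℤ)
    (hmin : minpoly ℚ θ =
      Polynomial.X ^ 3 - Polynomial.C (a : ℚ) * Polynomial.X + Polynomial.C (b : ℚ))
    (hgen : IntermediateField.adjoin ℚ {θ} = ⊤)
    (p q : ℕ) (hp : p.Prime) (hq : q.Prime) (hpq : p ≠ q) (hp5 : 5 ≤ p) (hq5 : 5 ≤ q)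
    (hcp : IdealEntropy.ConditionOne a b p ∨ IdealEntropy.ConditionTwo a b p)
    (hcq : IdealEntropy.ConditionOne a b q ∨ IdealEntropy.ConditionTwo a b q) :
    IdealEntropy.IsPrimeMulPrimeSq
        (Ideal.span {(p : NumberField.RingOfIntegers K)}) ∧
      IdealEntropy.IsPrimeMulPrimeSq
        (Ideal.span {(q : NumberField.RingOfIntegers K)}) ∧
      IdealEntropy.entropy (Ideal.span {(p : NumberField.RingOfIntegers K)}) =
        IdealEntropy.entropy (Ideal.span {(q : NumberField.RingOfIntegers K)}) ∧
      IdealEntropy.divergence (Ideal.span {(p : NumberField.RingOfIntegers K)})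
        (Ideal.span {(q : NumberField.RingOfIntegers K)}) = 0 := by
  have hP := IdealEntropy.isPrimeMulPrimeSq_of_condition hmin hgen hp hp5 hcp
  have hQ := IdealEntropy.isPrimeMulPrimeSq_of_condition hmin hgen hq hq5 hcq
  exact ⟨hP, hQ, hP.entropy_eq.trans hQ.entropy_eq.symm, hP.divergence_eq_zero hQ⟩
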